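/- Let $X$ be a cosmic space, i.e. a Tychonoff space with a countable network (a family of subsets of $X$ such that every open set is a union of members of the family), and let $C_p(X)$ be the space of all continuous functions $X\to\mathbb R$ with the topology of pointwise convergence. Then the following are equivalent: 1. $C_p(X)$ is strongly sequentially separable; 2. $C_p(X)$ is hereditarily $F$-separable; 3. $C_p(X)$ is hereditarily $\sigma$-separable; 4. $C_p(X)$ is Fréchet–Urysohn; 5. $X$ is a $\gamma$-space. Here, for a topological space $Y$ and $A\subseteq Y$, $[A]$ denotes the closure of $A$ and $[A]_s$ the set of all limits of sequences of points of $A$. - $Y$ is *strongly sequentially separable* if it is separable and $[A]_s=Y$ for every countable dense $A\subseteq Y$. - $Y$ is *Fréchet–Urysohn* if $[A]=[A]_s$ for every $A\subseteq Y$. - The *$\sigma$-closure* of $A$ is the set of all $x\in[A]_s$ such that, for every sequence $(x_n)$ of points of $A$ converging to $x$ with $x\in[A\setminus\{x_n:n\in\mathbb N\}]$, there is a sequence of points of $A\setminus\{x_n:n\in\mathbb N\}$ converging to $x$. - The *$F$-closure* of $A$ is the set of all $x\in[A]$ such that, for every $A'\subseteq A$ with $x\in[A']$, there is a sequence of points of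 $A'$ converging to $x$. - $Y$ is *$\sigma$-separable* (*$F$-separable*) if some countable $A\subseteq Y$ has $\sigma$-closure ($F$-closure) equal to $Y$, and *hereditarily* so if every subspace of $Y$ is. - An *open cover* of $X$ is a family of proper open subsets of $X$ with union $X$. It is an *$\omega$-cover* if every finite subset of $X$ is contained in some member, and a *$\gamma$-cover* if it is infinite and every point of $X$ belongs to all but finitely many members. $X$ is a *$\gamma$-space* if every open $\omega$-cover of $X$ contains an open $\gamma$-cover of $X$. -/

import Mathlib

open Set Filter Topology

namespace CpTheory

/-- A family `N` of subsets of `X` is a network if every open set is the union of a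
subfamily of `N`. -/
def IsNetwork {X : Type*} [TopologicalSpace X] (N : Set (Set X)) : Prop :=
  ∀ U : Set X, IsOpen U → ∃ T ⊆ N, ⋃₀ T = U

/-- A cosmic space: a space with a countable network. -/
def IsCosmic (X : Type*) [TopologicalSpace X] : Prop :=
  ∃ N : Set (Set X), N.Countable ∧ IsNetwork N

/-- `C_p(X)`: the continuous functions `X → ℝ` with the topology of pointwise convergence,
that is, the subspace topology inherited from the product `X → ℝ`. -/
abbrev Cp (X : Type*) [TopologicalSpace X] : Type _ := {f : X → ℝ // Continuous f}

/-- `A` is sequentially dense if every point is the limit of a sequence of points of `A`. -/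
def SeqDense {X : Type*} [TopologicalSpace X] (A : Set X) : Prop :=
  seqClosure A = univ

/-- Strongly sequentially separable: separable, and every countable dense subset is
sequentially dense. -/
def StronglySeqSeparable (X : Type*) [TopologicalSpace X] : Prop :=
  TopologicalSpace.SeparableSpace X ∧ ∀ A : Set X, A.Countable → Dense A → SeqDense A

/-- The `σ`-closure of `A`. -/
def sigmaClosure {X : Type*} [TopologicalSpace X] (A : Set X) : Set X :=
  {x | x ∈ seqClosure A ∧
    ∀ u : ℕ → X, (∀ n, u n ∈ A) → Tendsto u atTop (𝓝 x) → x ∈ closure (A \ range u) →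
      x ∈ seqClosure (A \ range u)}

/-- `σ`-separable: there is a countable set whose `σ`-closure is the whole space. -/
def SigmaSeparable (X : Type*) [TopologicalSpace X] : Prop :=
  ∃ A : Set X, A.Countable ∧ sigmaClosure A = univ

/-- The `F`-closure of `A`: the points `x` of the closure of `A` such that, whenever `x` lies in
the closure of a subset `B` of `A`, some sequence of points of `B` converges to `x`. -/
def fClosure {X : Type*} [TopologicalSpace X] (A : Set X) : Set X :=
  {x | x ∈ closure A ∧ ∀ B ⊆ A, x ∈ closure B → x ∈ seqClosure B}

/-- `F`-separable: there is a countable set whose `F`-closure is the whole space. -/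
def FSeparable (X : Type*) [TopologicalSpace X] : Prop :=
  ∃ A : Set X, A.Countable ∧ fClosure A = univ

/-- Every subspace is `σ`-separable. -/
def HereditarilySigmaSeparable (X : Type*) [TopologicalSpace X] : Prop :=
  ∀ S : Set X, SigmaSeparable S

/-- Every subspace is `F`-separable. -/
def HereditarilyFSeparable (X : Type*) [TopologicalSpace X] : Prop :=
  ∀ S : Set X, FSeparable S

/-- An open cover: a family of proper open subsets whose union is the whole space. -/
def IsProperOpenCover {X : Type*} [TopologicalSpace X] (U : Set (Set X)) : Prop :=
  (∀ V ∈ U, IsOpen V ∧ V ≠ univ) ∧ ⋃₀ U = univ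

/-- An open `ω`-cover: every finite subset of the space lies in some member of the cover. -/
def IsOmegaCover {X : Type*} [TopologicalSpace X] (U : Set (Set X)) : Prop :=
  IsProperOpenCover U ∧ ∀ F : Set X, F.Finite → ∃ V ∈ U, F ⊆ V

/-- An open `γ`-cover: an infinite open cover such that every point belongs to all but finitely
many members. -/
def IsGammaCover {X : Type*} [TopologicalSpace X] (U : Set (Set X)) : Prop :=
  IsProperOpenCover U ∧ U.Infinite ∧ ∀ x : X, {V ∈ U | x ∉ V}.Finite

/-- A `γ`-space: every open `ω`-cover contains an open `γ`-cover. -/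
def IsGammaSpace (X : Type*) [TopologicalSpace X] : Prop :=
  ∀ U : Set (Set X), IsOmegaCover U → ∃ V ⊆ U, IsGammaCover V

end CpTheory

namespace CpTheory

/-! A countable network on `X` induces one on `Cp X`, so every subspace of `Cp X` is separable. If
`Cp X` is Fréchet–Urysohn, so are its subspaces, and any dense set has full `F`-closure; this gives
1 and 2, hence 3. Conversely, `σ`-separability of the subspaces `A ∪ {x}` already yields the
sequences that Fréchet–Urysohn asks for.

Covers enter in 1 → 5 and 5 → 4. A sequence converging to `0`, each term equal to `1` off a member
of an `ω`-cover, selects a `γ`-cover. In the other direction, `f ∈ closure A` makes the sets on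
which some `a ∈ A` is close to `f` an `ω`-cover, and a `γ`-subcover of it encodes a sequence in `A`
tending to `f`. -/

/-- Every open neighbourhood of a point contains a member of the network
containing the point. -/
theorem IsNetwork.exists_mem_subset {X : Type*} [TopologicalSpace X] {N : Set (Set X)}
    (hN : IsNetwork N) {U : Set X} (hU : IsOpen U) {x : X} (hx : x ∈ U) :
    ∃ M ∈ N, x ∈ M ∧ M ⊆ U := by
  obtain ⟨T, hTN, rfl⟩ := hN U hU
  obtain ⟨M, hM, hxM⟩ := hx
  exact ⟨M, hTN hM, hxM, subset_sUnion_of_mem hM⟩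

theorem isNetwork_of_forall_exists {X : Type*} [TopologicalSpace X] {N : Set (Set X)}
    (h : ∀ U : Set X, IsOpen U → ∀ x ∈ U, ∃ M ∈ N, x ∈ M ∧ M ⊆ U) : IsNetwork N := by
  intro U hU
  refine ⟨{M ∈ N | M ⊆ U}, sep_subset _ _, Subset.antisymm (sUnion_subset fun M hM => hM.2) ?_⟩
  intro x hx
  obtain ⟨M, hM, hxM, hMU⟩ := h U hU x hx
  exact ⟨M, ⟨hM, hMU⟩, hxM⟩

/-- Every subset of a cosmic space has a countable dense subset. -/
theorem IsCosmic.exists_countable_subset_closure {X : Type*} [TopologicalSpace X]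
    (hX : IsCosmic X) (S : Set X) : ∃ D ⊆ S, D.Countable ∧ S ⊆ closure D := by
  obtain ⟨N, hNc, hN⟩ := hX
  have hch : ∀ M : {M ∈ N | (M ∩ S).Nonempty}, ∃ x, x ∈ (M : Set X) ∩ S := fun M => M.2.2
  choose p hp using hch
  have : Countable {M ∈ N | (M ∩ S).Nonempty} := (hNc.mono (sep_subset _ _)).to_subtype
  refine ⟨range p, range_subset_iff.2 fun M => (hp M).2, countable_range p, ?_⟩
  intro x hx
  rw [mem_closure_iff]
  intro U hU hxU
  obtain ⟨M, hM, hxM, hMU⟩ := hN.exists_mem_subset hU hxU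
  exact ⟨p ⟨M, hM, x, hxM, hx⟩, hMU (hp ⟨M, hM, x, hxM, hx⟩).1, mem_range_self _⟩

theorem IsCosmic.separableSpace_coe {X : Type*} [TopologicalSpace X]
    (hX : IsCosmic X) (S : Set X) : TopologicalSpace.SeparableSpace S := by
  obtain ⟨D, hDS, hDc, hD⟩ := hX.exists_countable_subset_closure S
  refine ⟨⟨(↑) ⁻¹' D, hDc.preimage Subtype.val_injective, ?_⟩⟩
  intro x
  rw [closure_subtype, Subtype.image_preimage_coe, inter_eq_self_of_subset_right hDS]
  exact hD x.2

theorem IsCosmic.separableSpace {X : Type*} [TopologicalSpace X] (hX : IsCosmic X) :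
    TopologicalSpace.SeparableSpace X := by
  obtain ⟨D, -, hDc, hD⟩ := hX.exists_countable_subset_closure univ
  exact ⟨⟨D, hDc, fun x => hD (mem_univ x)⟩⟩

/-- The sets `{g | ∀ x ∈ F, |g x - f x| < ε}` form a neighbourhood base at `f` in `C_p(X)`. -/
theorem Cp.exists_finset_forall_mem {X : Type*} [TopologicalSpace X] {U : Set (Cp X)}
    (hU : IsOpen U) {f : Cp X} (hf : f ∈ U) :
    ∃ F : Finset X, ∃ ε > 0, ∀ g : Cp X, (∀ x ∈ F, |g.1 x - f.1 x| < ε) → g ∈ U := by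
  obtain ⟨O, hO, rfl⟩ := isOpen_induced_iff.1 hU
  obtain ⟨F, u, hu, hsub⟩ := isOpen_pi_iff.1 hO f.1 hf
  have hε : ∀ x : X, ∃ ε > 0, x ∈ F → Metric.ball (f.1 x) ε ⊆ u x := by
    intro x
    by_cases hx : x ∈ F
    · obtain ⟨ε, h0, h⟩ := Metric.isOpen_iff.1 (hu x hx).1 _ (hu x hx).2
      exact ⟨ε, h0, fun _ => h⟩
    · exact ⟨1, one_pos, fun h => absurd h hx⟩
  choose ε hε0 hε using hε
  obtain ⟨δ, hδ0, hδ⟩ : ∃ δ > 0, ∀ x ∈ F, δ ≤ ε x := by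
    rcases F.eq_empty_or_nonempty with rfl | hne
    · exact ⟨1, one_pos, by simp⟩
    · obtain ⟨y, -, hy⟩ := F.exists_min_image ε hne
      exact ⟨ε y, hε0 y, hy⟩
  refine ⟨F, δ, hδ0, fun g hg => hsub fun x hx => hε x hx ?_⟩
  rw [Metric.mem_ball, Real.dist_eq]
  exact (hg x hx).trans_le (hδ x hx)

theorem Cp.isOpen_setOf_forall_abs_sub_lt {X : Type*} [TopologicalSpace X] (f : Cp X)
    {F : Set X} (hF : F.Finite) (ε : ℝ) :
    IsOpen {g : Cp X | ∀ x ∈ F, |g.1 x - f.1 x| < ε} := by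
  simp only [ofPred_forall]
  refine hF.isOpen_biInter fun x _ => ?_
  refine isOpen_lt ?_ continuous_const
  exact (((continuous_apply x).comp continuous_subtype_val).sub continuous_const).abs

theorem Cp.tendsto_iff {X ι : Type*} [TopologicalSpace X] {l : Filter ι} {u : ι → Cp X}
    {f : Cp X} : Tendsto u l (𝓝 f) ↔ ∀ x, Tendsto (fun i => (u i).1 x) l (𝓝 (f.1 x)) := by
  rw [tendsto_subtype_rng, tendsto_pi_nhds]

/-- If `X` is cosmic, then so is `C_p(X)`. -/
theorem IsCosmic.cp {X : Type*} [TopologicalSpace X] (hX : IsCosmic X) : IsCosmic (Cp X) := by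
  obtain ⟨N, hNc, hN⟩ := hX
  -- Finitely many conditions "`f` maps a network member into a rational interval": only countably
  -- many such sets arise.
  let W : Set (Set X × ℚ × ℚ) → Set (Cp X) := fun T =>
    {f | ∀ t ∈ T, ∀ x ∈ t.1, (t.2.1 : ℝ) < f.1 x ∧ f.1 x < t.2.2}
  refine ⟨W '' {T | T.Finite ∧ T ⊆ N ×ˢ univ}, ?_, isNetwork_of_forall_exists ?_⟩
  · exact (countable_ofPred_finite_subset (hNc.prod countable_univ)).image W
  intro U hU f hf
  obtain ⟨F, ε, hε, hFU⟩ := Cp.exists_finset_forall_mem hU hf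
  have hch : ∀ x : X, ∃ t ∈ N ×ˢ (univ : Set (ℚ × ℚ)), x ∈ t.1 ∧
      (∀ y ∈ t.1, (t.2.1 : ℝ) < f.1 y ∧ f.1 y < t.2.2) ∧
      f.1 x - ε < t.2.1 ∧ (t.2.2 : ℝ) < f.1 x + ε := by
    intro x
    obtain ⟨p, hp1, hp2⟩ := exists_rat_btwn (show f.1 x - ε < f.1 x by linarith)
    obtain ⟨q, hq1, hq2⟩ := exists_rat_btwn (show f.1 x < f.1 x + ε by linarith)
    obtain ⟨M, hM, hxM, hMU⟩ := hN.exists_mem_subset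
      ((isOpen_Ioo (a := (p : ℝ)) (b := q)).preimage f.2) (x := x) ⟨hp2, hq1⟩
    exact ⟨(M, p, q), ⟨hM, mem_univ _⟩, hxM, fun y hy => hMU hy, hp1, hq2⟩
  choose t htN hxt htf ht1 ht2 using hch
  refine ⟨_, ⟨t '' F, ⟨F.finite_toSet.image t, ?_⟩, rfl⟩, ?_, ?_⟩
  · rintro _ ⟨x, -, rfl⟩
    exact htN x
  · rintro _ ⟨x, -, rfl⟩ y hy
    exact htf x y hy
  · intro g hg
    refine hFU g fun x hx => ?_
    obtain ⟨h1, h2⟩ := hg (t x) (mem_image_of_mem t hx) x (hxt x)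
    rw [abs_lt]
    constructor <;> linarith [ht1 x, ht2 x]

theorem fClosure_eq_univ_of_dense {Y : Type*} [TopologicalSpace Y] [FrechetUrysohnSpace Y]
    {A : Set Y} (hA : Dense A) : fClosure A = univ := by
  refine eq_univ_of_forall fun x => ⟨hA x, fun B _ hB => ?_⟩
  rwa [seqClosure_eq_closure]

theorem fClosure_subset_sigmaClosure {Y : Type*} [TopologicalSpace Y] (A : Set Y) :
    fClosure A ⊆ sigmaClosure A :=
  fun _ hx => ⟨hx.2 A Subset.rfl hx.1, fun _ _ _ h => hx.2 _ sdiff_subset h⟩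

theorem FSeparable.sigmaSeparable {Y : Type*} [TopologicalSpace Y] (h : FSeparable Y) :
    SigmaSeparable Y := by
  obtain ⟨A, hAc, hA⟩ := h
  exact ⟨A, hAc, univ_subset_iff.1 (hA ▸ fClosure_subset_sigmaClosure A)⟩

theorem IsCosmic.hereditarilyFSeparable {Y : Type*} [TopologicalSpace Y]
    [FrechetUrysohnSpace Y] (hY : IsCosmic Y) : HereditarilyFSeparable Y := by
  intro S
  have := hY.separableSpace_coe S
  have : FrechetUrysohnSpace S := Topology.IsInducing.subtypeVal.frechetUrysohnSpace
  obtain ⟨A, hAc, hA⟩ := TopologicalSpace.exists_countable_dense S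
  exact ⟨A, hAc, fClosure_eq_univ_of_dense hA⟩

/-- A non-isolated point of a `σ`-separable `T₁` space `Y` is the limit of a sequence of other
points. -/
theorem SigmaSeparable.mem_seqClosure_compl_singleton {Y : Type*} [TopologicalSpace Y]
    [T1Space Y] (hY : SigmaSeparable Y) {x : Y} (hx : x ∈ closure ({x}ᶜ : Set Y)) :
    x ∈ seqClosure ({x}ᶜ : Set Y) := by
  obtain ⟨D, -, hD⟩ := hY
  have hDd : Dense D := fun y =>
    seqClosure_subset_closure (hD.symm ▸ mem_univ y : y ∈ sigmaClosure D).1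
  have hxD : x ∈ closure (D \ {x}) := by
    refine closure_minimal ?_ isClosed_closure hx
    have := hDd.open_subset_closure_inter (isOpen_compl_singleton (x := x))
    rwa [inter_comm] at this
  have hmono : seqClosure (D \ {x}) ⊆ seqClosure ({x}ᶜ : Set Y) := by
    rintro y ⟨u, hu, hlim⟩
    exact ⟨u, fun n => (hu n).2, hlim⟩
  by_cases hxm : x ∈ D
  · have h := (hD.symm ▸ mem_univ x : x ∈ sigmaClosure D).2 (fun _ => x) (fun _ => hxm)
      tendsto_const_nhds
    rw [range_const] at h
    exact hmono (h hxD)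
  · have h := (hD.symm ▸ mem_univ x : x ∈ sigmaClosure D).1
    rw [← sdiff_singleton_eq_self hxm] at h
    exact hmono h

/-- For `x ∉ A`, the complement of `x` in the subspace `insert x A` is `A` itself, and `x` is not
isolated there. -/
theorem HereditarilySigmaSeparable.frechetUrysohnSpace {Y : Type*} [TopologicalSpace Y]
    [T1Space Y] (hY : HereditarilySigmaSeparable Y) : FrechetUrysohnSpace Y := by
  refine ⟨fun A x hx => ?_⟩
  by_cases hxA : x ∈ A
  · exact subset_seqClosure hxA
  have himg : (Subtype.val : ↥(insert x A : Set Y) → Y) '' ({⟨x, mem_insert x A⟩}ᶜ : Set _) = A := by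
    ext y
    constructor
    · rintro ⟨⟨z, hz⟩, hzx, rfl⟩
      exact hz.resolve_left fun h => hzx (Subtype.ext h)
    · intro h
      refine ⟨⟨y, mem_insert_of_mem x h⟩, fun e => ?_, rfl⟩
      obtain rfl : y = x := congrArg Subtype.val e
      exact hxA h
  obtain ⟨u, hu, hlim⟩ := (hY (insert x A)).mem_seqClosure_compl_singleton
    (x := ⟨x, mem_insert x A⟩) (by rwa [closure_subtype, himg])
  refine ⟨fun n => u n, fun n => ?_, ?_⟩
  · exact himg.subset (mem_image_of_mem _ (hu n))
  · exact (continuous_subtype_val.tendsto _).comp hlim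

theorem IsCosmic.stronglySeqSeparable {Y : Type*} [TopologicalSpace Y]
    [FrechetUrysohnSpace Y] (hY : IsCosmic Y) : StronglySeqSeparable Y :=
  ⟨hY.separableSpace, fun A _ hA => by rw [SeqDense, seqClosure_eq_closure, hA.closure_eq]⟩

/-- In a completely regular space, a finite set can be separated from a disjoint closed set by a
continuous function. -/
theorem exists_continuous_eq_one_eq_zero {X : Type*} [TopologicalSpace X]
    [CompletelyRegularSpace X] {F V : Set X} (hF : F.Finite) (hV : IsOpen V) (hFV : F ⊆ V) :
    ∃ φ : X → ℝ, Continuous φ ∧ (∀ x ∈ F, φ x = 1) ∧ ∀ x ∉ V, φ x = 0 := by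
  have hpt : ∀ x : X, ∃ ψ : X → ℝ, Continuous ψ ∧ (x ∈ F → ψ x = 0 ∧ ∀ y ∉ V, ψ y = 1) := by
    intro x
    by_cases hx : x ∈ F
    · obtain ⟨g, hg, hg0, hg1⟩ := CompletelyRegularSpace.completely_regular x Vᶜ
        hV.isClosed_compl (fun h => h (hFV hx))
      refine ⟨fun y => g y, continuous_subtype_val.comp hg, fun _ => ⟨by simp [hg0], ?_⟩⟩
      intro y hy
      simp [hg1 hy]
    · exact ⟨fun _ => 0, continuous_const, fun h => absurd h hx⟩
  choose ψ hψ hψF using hpt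
  refine ⟨fun y => 1 - ∏ x ∈ hF.toFinset, ψ x y,
    continuous_const.sub (continuous_finsetProd _ fun x _ => hψ x), ?_, ?_⟩
  · intro x hx
    have : ∏ z ∈ hF.toFinset, ψ z x = 0 :=
      Finset.prod_eq_zero (hF.mem_toFinset.2 hx) (hψF x hx).1
    simp only [this, sub_zero]
  · intro y hy
    have : ∏ z ∈ hF.toFinset, ψ z y = 1 :=
      Finset.prod_eq_one fun z hz => (hψF z (hF.mem_toFinset.1 hz)).2 y hy
    simp only [this, sub_self]

/-- If `U` is an open `ω`-cover, the functions equal to `1` off some member of `U` are dense in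
`C_p(X)`. -/
theorem IsOmegaCover.dense_setOf_eq_one {X : Type*} [TopologicalSpace X]
    [CompletelyRegularSpace X] {U : Set (Set X)} (hU : IsOmegaCover U) :
    Dense {f : Cp X | ∃ V ∈ U, ∀ x ∉ V, f.1 x = 1} := by
  intro f
  rw [mem_closure_iff]
  intro O hO hfO
  obtain ⟨F, ε, hε, hF⟩ := Cp.exists_finset_forall_mem hO hfO
  obtain ⟨V, hVU, hFV⟩ := hU.2 F F.finite_toSet
  obtain ⟨φ, hφ, hφ1, hφ0⟩ :=
    exists_continuous_eq_one_eq_zero F.finite_toSet (hU.1.1 V hVU).1 hFV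
  have hf := f.2
  -- The cutoff `φ` blends `f`, kept on `F`, with the constant `1`, taken off `V`.
  refine ⟨⟨fun x => φ x * f.1 x + (1 - φ x), by fun_prop⟩, hF _ fun x hx => ?_, V, hVU, ?_⟩
  · simpa [hφ1 x hx] using hε
  · intro x hx
    simp [hφ0 x hx]

/-- A sequence of proper open sets such that every point lies in almost all of them enumerates a
`γ`-cover. -/
theorem isGammaCover_range {X : Type*} [TopologicalSpace X] {V : ℕ → Set X}
    (hV : ∀ n, IsOpen (V n) ∧ V n ≠ univ) (h : ∀ x, ∀ᶠ n in atTop, x ∈ V n) :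
    IsGammaCover (range V) := by
  have hfin : ∀ x, {W ∈ range V | x ∉ W}.Finite := by
    intro x
    have hx : {n | x ∉ V n}.Finite := by
      rw [← Nat.cofinite_eq_atTop] at h
      exact h x
    refine (hx.image V).subset ?_
    rintro _ ⟨⟨n, rfl⟩, hn⟩
    exact ⟨n, hn, rfl⟩
  -- A set occurring infinitely often would contain every point, yet each `V n` is proper. Hence the
  -- range is infinite.
  have hfreq : ∀ W, ¬ ∃ᶠ n in atTop, V n = W := by
    intro W hW
    obtain ⟨n, hn⟩ := hW.exists
    refine (hV n).2 (eq_univ_of_forall fun x => ?_)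
    obtain ⟨m, hm, hx⟩ := (hW.and_eventually (h x)).exists
    rwa [hn, ← hm]
  refine ⟨⟨forall_mem_range.2 hV, eq_univ_of_forall fun x => ?_⟩, fun hinf => ?_, hfin⟩
  · obtain ⟨n, hn⟩ := (h x).exists
    exact ⟨V n, mem_range_self n, hn⟩
  · have : ∀ᶠ n in atTop, ∀ W ∈ range V, V n ≠ W :=
      hinf.eventually_all.2 fun W _ => not_frequently.1 (hfreq W)
    obtain ⟨n, hn⟩ := this.exists
    exact hn (V n) (mem_range_self n) rfl

theorem StronglySeqSeparable.isGammaSpace {X : Type*} [TopologicalSpace X]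
    [CompletelyRegularSpace X] (hX : IsCosmic X) (h : StronglySeqSeparable (Cp X)) :
    IsGammaSpace X := by
  intro U hU
  obtain ⟨A, hAsub, hAc, hA⟩ :=
    hX.cp.exists_countable_subset_closure {f : Cp X | ∃ V ∈ U, ∀ x ∉ V, f.1 x = 1}
  have hAd : Dense A := dense_closure.1 (hU.dense_setOf_eq_one.mono hA)
  have h0 : (⟨fun _ => 0, continuous_const⟩ : Cp X) ∈ seqClosure A := by
    rw [show seqClosure A = univ from h.2 A hAc hAd]
    exact mem_univ _
  obtain ⟨a, haA, ha⟩ := h0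
  choose V hVU hV using fun n => hAsub (haA n)
  refine ⟨range V, range_subset_iff.2 hVU, isGammaCover_range (fun n => hU.1.1 _ (hVU n)) ?_⟩
  intro x
  filter_upwards [(Cp.tendsto_iff.1 ha x).eventually_lt_const one_pos] with n hn
  by_contra hx
  exact hn.ne (hV n x hx)

theorem Cp.frechetUrysohnSpace_of_finite {X : Type*} [TopologicalSpace X] [Finite X] :
    FrechetUrysohnSpace (Cp X) := by
  have := Fintype.ofFinite X
  infer_instance

theorem IsGammaSpace.frechetUrysohnSpace {X : Type*} [TopologicalSpace X] [T1Space X]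
    (hX : IsGammaSpace X) : FrechetUrysohnSpace (Cp X) := by
  cases finite_or_infinite X
  · exact Cp.frechetUrysohnSpace_of_finite
  -- Infinitely many distinct points `p n` are available. Deleting `p n` makes `W n a` proper and
  -- lets the cover record the precision `n`; a finite set misses some `p n`, so the `ω`-property
  -- survives.
  refine ⟨fun A f hf => ?_⟩
  let p : ℕ ↪ X := Infinite.natEmbedding X
  let W : ℕ → Cp X → Set X := fun n a => {x | |a.1 x - f.1 x| < 1 / ((n : ℝ) + 1)} \ {p n}
  let U : Set (Set X) := {V | ∃ n, ∃ a ∈ A, W n a = V}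
  have hfin : ∀ F : Set X, F.Finite → ∃ V ∈ U, F ⊆ V := by
    intro F hF
    obtain ⟨n, hn⟩ := (hF.preimage p.injective.injOn).exists_notMem
    obtain ⟨a, ha, haA⟩ := mem_closure_iff.1 hf _
      (Cp.isOpen_setOf_forall_abs_sub_lt f hF (1 / ((n : ℝ) + 1))) (by
        intro x _
        rw [sub_self, abs_zero]
        positivity)
    refine ⟨W n a, ⟨n, a, haA, rfl⟩, fun x hx => ⟨ha x hx, ?_⟩⟩
    rintro rfl
    exact hn hx
  have hU : IsOmegaCover U := by
    refine ⟨⟨?_, eq_univ_of_forall fun x => ?_⟩, hfin⟩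
    · rintro _ ⟨n, a, -, rfl⟩
      refine ⟨IsOpen.sdiff (isOpen_lt ?_ continuous_const) isClosed_singleton, fun h => ?_⟩
      · exact (a.2.sub f.2).abs
      · exact (h.symm ▸ mem_univ (p n) : p n ∈ W n a).2 rfl
    · obtain ⟨V, hV, hx⟩ := hfin {x} (finite_singleton x)
      exact ⟨V, hV, hx rfl⟩
  obtain ⟨G, hGU, -, hGinf, hG⟩ := hX U hU
  let V : ℕ ↪ G := hGinf.natEmbedding
  have hmem : ∀ x, ∀ᶠ j in atTop, x ∈ (V j : Set X) := by
    intro x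
    rw [← Nat.cofinite_eq_atTop]
    exact ((hG x).preimage ((Subtype.val_injective.comp V.injective).injOn)).subset
      fun j hj => ⟨(V j).2, hj⟩
  choose n a haA hW using fun j => hGU (V j).2
  -- The point `p m` lies in almost all `V j`, but in none with `n j = m`; so each precision is used
  -- finitely often.
  have hn : Tendsto n atTop atTop := by
    rw [← Nat.cofinite_eq_atTop]
    refine Tendsto.cofinite_of_finite_preimage_singleton fun m => ?_
    have h := hmem (p m)
    rw [← Nat.cofinite_eq_atTop] at h
    refine Finite.subset h fun j hj hpj => ?_
    have hpj' : p m ∈ W (n j) (a j) := (hW j).symm ▸ hpj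
    rw [show n j = m from hj] at hpj'
    exact hpj'.2 rfl
  refine ⟨a, haA, Cp.tendsto_iff.2 fun x => ?_⟩
  rw [tendsto_iff_dist_tendsto_zero]
  refine squeeze_zero' (Eventually.of_forall fun _ => dist_nonneg) ?_
    (tendsto_one_div_add_atTop_nhds_zero_nat.comp hn)
  filter_upwards [hmem x] with j hj
  rw [← hW j] at hj
  exact hj.1.le

end CpTheory

theorem mainTheorem4 {X : Type*} [TopologicalSpace X] [T35Space X] (hX : CpTheory.IsCosmic X) :
    List.TFAE
      [CpTheory.StronglySeqSeparable (CpTheory.Cp X),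
       CpTheory.HereditarilyFSeparable (CpTheory.Cp X),
       CpTheory.HereditarilySigmaSeparable (CpTheory.Cp X),
       FrechetUrysohnSpace (CpTheory.Cp X),
       CpTheory.IsGammaSpace X] := by
  tfae_have 1 → 5 := fun h => h.isGammaSpace hX
  tfae_have 5 → 4 := fun h => h.frechetUrysohnSpace
  tfae_have 4 → 1 := fun _ => hX.cp.stronglySeqSeparable
  tfae_have 4 → 2 := fun _ => hX.cp.hereditarilyFSeparable
  tfae_have 2 → 3 := fun h S => (h S).sigmaSeparable
  tfae_have 3 → 4 := fun h => h.frechetUrysohnSpace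
  tfae_finish
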